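/- Let $m,n\in\mathbb N$, $t:=\min\{m,n\}$, $\lambda>0$, and let $\|\cdot\|$ be a unitarily invariant norm on $\mathbb R^{m\times n}$, i.e. a norm with $\|UXV^{T}\|=\|X\|$ for all $X\in\mathbb R^{m\times n}$ and all orthogonal $U\in\mathbb R^{m\times m}$, $V\in\mathbb R^{n\times n}$. For $X\in\mathbb R^{m\times n}$ let $\sigma(X)\in\mathbb R^t$ be the vector of its singular values in decreasing order, counted with multiplicity. A symmetric gauge function on $\mathbb R^t$ is a convex, positively homogeneous function $g:\mathbb R^t\to[0,\infty)$ with $g(0)=0$ that is invariant under permutations and sign changes of the coordinates. There is exactly one symmetric gauge function $g$ on $\mathbb R^t$ with $\|X\|=g(\sigma(X))$ for all $X\in\mathbb R^{m\times n}$. For this $g$ the following holds. Let $X=U\Sigma_XV^{T}$ be a singular value decomposition, i.e. $U,V$ are orthogonal and $\Sigma_X\in\mathbb R^{m\times n}$ is the rectangular diagonal matrix whose diagonal $s\in\mathbb R^t$ has nonnegative entries (the singular values of $X$, in any order; for example $s=\sigma(X)$). Then $$\mathrm{prox}_{\lambda\|\cdot\|}(X):=\operatorname*{argmin}_{Y\in\mathbb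 R^{m\times n}}\Big\{\tfrac1{2\lambda}\|X-Y\|_{\mathcal F}^2+\|Y\|\Big\}\qquad\text{and}\qquad \mathrm{prox}_{\lambda g}(s):=\operatorname*{argmin}_{y\in\mathbb R^{t}}\Big\{\tfrac1{2\lambda}\|s-y\|_2^2+g(y)\Big\}$$ (where $\|\cdot\|_{\mathcal F}$ is the Frobenius norm and $\|\cdot\|_2$ the Euclidean norm) each consist of exactly one point, $\hat X$ and $\hat s$ respectively; $\hat s$ has nonnegative entries and, with $\Sigma_{\hat X}\in\mathbb R^{m\times n}$ the rectangular diagonal matrix with diagonal $\hat s$, $\hat X=U\Sigma_{\hat X}V^{T}$ is a singular value decomposition of $\hat X$. Moreover $\mathrm{prox}_{\lambda g}(\sigma(X))$ also consists of exactly one point, and $$\sigma(\hat X)=\mathrm{prox}_{\lambda g}(\sigma(X)).$$ -/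

import Mathlib

open scoped Matrix Matrix.Norms.Frobenius

noncomputable section

/-- The (set-valued) proximal operator of `lam * f` on a normed space: the set of all global
minimizers of `y ↦ ‖x - y‖² / (2 * lam) + f y`. It is used below for the Euclidean norm on `ℝᵗ`
and for the Frobenius norm on real matrices. -/
def proxSet {E : Type*} [NormedAddCommGroup E] (lam : ℝ) (f : E → ℝ) (x : E) : Set E :=
  {p | ∀ y : E, 1 / (2 * lam) * ‖x - p‖ ^ 2 + f p ≤ 1 / (2 * lam) * ‖x - y‖ ^ 2 + f y}

/-- `N` is a norm on the real `m × n` matrices that is invariant under multiplication by orthogonal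
(that is, real unitary) matrices on both sides. -/
structure IsUnitarilyInvariantNorm {m n : ℕ} (N : Seminorm ℝ (Matrix (Fin m) (Fin n) ℝ)) :
    Prop where
  eq_zero_of_map_eq_zero : ∀ X, N X = 0 → X = 0
  invariant : ∀ (X : Matrix (Fin m) (Fin n) ℝ),
    ∀ U ∈ Matrix.orthogonalGroup (Fin m) ℝ, ∀ V ∈ Matrix.orthogonalGroup (Fin n) ℝ,
      N (U * X * Vᵀ) = N X

/-- The symmetric gauge functions on `ℝᵈ`. -/
structure IsSymmetricGauge {d : ℕ} (g : EuclideanSpace ℝ (Fin d) → ℝ) : Prop where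
  nonneg : ∀ x, 0 ≤ g x
  map_zero : g 0 = 0
  pos_homogeneous : ∀ (a : ℝ), 0 < a → ∀ x, g (a • x) = a * g x
  convex : ConvexOn ℝ Set.univ g
  symmetric : ∀ (ε : Fin d → ℝ), (∀ i, ε i = 1 ∨ ε i = -1) → ∀ (π : Equiv.Perm (Fin d)) x,
    g (WithLp.toLp 2 fun i => ε i * x (π i)) = g x

/-- The vector `σ(X) ∈ ℝᵗ`, `t = min m n`, of the singular values of `X`, in decreasing order and
counted with multiplicity. -/
def singularVector {m n : ℕ} (X : Matrix (Fin m) (Fin n) ℝ) : EuclideanSpace ℝ (Fin (min m n)) :=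
  WithLp.toLp 2 fun i => (Matrix.toEuclideanLin X).singularValues i

/-- The `m × n` matrix with the vector `s ∈ ℝᵗ`, `t = min m n`, on its main diagonal and zeros
elsewhere. -/
def rectDiagonal {m n : ℕ} (s : EuclideanSpace ℝ (Fin (min m n))) : Matrix (Fin m) (Fin n) ℝ :=
  Matrix.of fun i j =>
    if h : (i : ℕ) = (j : ℕ) then s ⟨i, lt_min i.isLt (h ▸ j.isLt)⟩ else 0

/-- `X = U Σ Vᵀ` is a singular value decomposition, where `Σ` is the rectangular diagonal matrix
with the entries of `s` on its diagonal. The singular values may be listed in any order. -/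
structure IsSVD {m n : ℕ} (X : Matrix (Fin m) (Fin n) ℝ) (U : Matrix (Fin m) (Fin m) ℝ)
    (s : EuclideanSpace ℝ (Fin (min m n))) (V : Matrix (Fin n) (Fin n) ℝ) : Prop where
  left_mem : U ∈ Matrix.orthogonalGroup (Fin m) ℝ
  right_mem : V ∈ Matrix.orthogonalGroup (Fin n) ℝ
  nonneg : ∀ i, 0 ≤ s i
  eq : X = U * rectDiagonal s * Vᵀ

/-- `g` is a symmetric gauge function corresponding to the matrix norm `N`. -/
structure IsGaugeOf {m n : ℕ} (N : Seminorm ℝ (Matrix (Fin m) (Fin n) ℝ))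
    (g : EuclideanSpace ℝ (Fin (min m n)) → ℝ) : Prop where
  isSymmetricGauge : IsSymmetricGauge g
  norm_eq : ∀ X, N X = g (singularVector X)

end

/-!
Write `σ` for `singularVector` and `Diag` for `rectDiagonal`. The gauge of a unitarily invariant
norm `N` is `g s = N (Diag s)`. It is convex and homogeneous because `Diag` is linear. It is invariant
under signed permutations because those do not change `σ (Diag s)`, while `N` depends only on the
singular values: `N X = N (Diag (σ X))` by the singular value decomposition
(`exists_isSVD_singularVector`). That the diagonal of any decomposition `U * Diag s * Vᵀ` lists the
singular values up to order and sign (`exists_perm_singularVector`) is read off the characteristic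
polynomial of `XᵀX`, and it also makes the gauge unique (`IsGaugeOf.eq_map_rectDiagonal`).

For the proximal operator, the Frobenius norm and `N` are invariant under `Y ↦ U * Y * Vᵀ`, so one
may take `X = Diag s`. Passing from `Y` to the diagonal matrix with the same main diagonal does not increase
the Frobenius distance to `Diag s`, and does not increase `N` either, since the diagonal part is an
average of matrices `D Y D'` with sign matrices `D`, `D'`
(`IsUnitarilyInvariantNorm.map_rectDiagonal_diagPart_le`). Hence a minimizer of the vector problem
lifts to a minimizer of the matrix problem. Vector minimizers exist by coercivity, and in both
problems the parallelogram law gives uniqueness (`proxSet_subsingleton`). Uniqueness together with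
the symmetry of `g` makes the minimizer nonnegative for nonnegative `s`, equivariant under
permutations, and decreasing for decreasing `s`, which identifies it with `σ` of the lifted matrix.
-/

/-! ### The proximal operator -/

/-- Strict convexity of `y ↦ ‖x - y‖²`, in the form of the parallelogram law, excludes two
minimizers. -/
theorem proxSet_subsingleton {E : Type*} [NormedAddCommGroup E] [NormedSpace ℝ E]
    [InnerProductSpaceable E] {lam : ℝ} (hlam : 0 < lam) {f : E → ℝ}
    (hf : ConvexOn ℝ Set.univ f) (x : E) : (proxSet lam f x).Subsingleton := by
  intro p hp q hq
  have hc : 0 < 1 / (2 * lam) := by positivity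
  -- compare both points with their midpoint
  have h1 := hp ((1 / 2 : ℝ) • p + (1 / 2 : ℝ) • q)
  have h2 := hq ((1 / 2 : ℝ) • p + (1 / 2 : ℝ) • q)
  have h3 := hf.2 (Set.mem_univ p) (Set.mem_univ q) 
    (show (0 : ℝ) ≤ 1 / 2 by norm_num) (show (0 : ℝ) ≤ 1 / 2 by norm_num) (by norm_num)
  have h4 := InnerProductSpaceable.parallelogram_identity (x - p) (x - q)
  have h5 : x - p + (x - q) = (2 : ℝ) • (x - ((1 / 2 : ℝ) • p + (1 / 2 : ℝ) • q)) := by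
    module
  have h6 : x - p - (x - q) = -(p - q) := by abel
  rw [h5, h6, norm_smul, norm_neg, Real.norm_of_nonneg zero_le_two] at h4
  simp only [smul_eq_mul] at h3
  have h7 : 1 / (2 * lam) * ‖p - q‖ ^ 2 ≤ 0 := by
    have := congrArg (fun r => 1 / (2 * lam) * r) h4
    nlinarith
  have h8 : ‖p - q‖ ^ 2 ≤ 0 := by
    by_contra! h
    exact absurd h7 (not_le.2 (mul_pos hc h))
  have h9 : ‖p - q‖ = 0 := pow_eq_zero_iff two_ne_zero |>.1 (le_antisymm h8 (sq_nonneg _))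
  exact sub_eq_zero.1 (norm_eq_zero.1 h9)

theorem proxSet_nonempty {E : Type*} [NormedAddCommGroup E] [ProperSpace E]
    {lam : ℝ} (hlam : 0 < lam) {f : E → ℝ} (hf : Continuous f) (hf0 : ∀ y, 0 ≤ f y) (x : E) :
    (proxSet lam f x).Nonempty := by
  have hc : 0 < 1 / (2 * lam) := by positivity
  have hcont : Continuous fun y => 1 / (2 * lam) * ‖x - y‖ ^ 2 + f y := by fun_prop
  have hlim : Filter.Tendsto (fun y => 1 / (2 * lam) * ‖x - y‖ ^ 2 + f y)
      (Filter.cocompact E) Filter.atTop := by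
    refine Filter.tendsto_atTop_mono (fun y => le_add_of_nonneg_right (hf0 y)) ?_
    refine Filter.Tendsto.const_mul_atTop hc ?_
    refine (Filter.tendsto_pow_atTop two_ne_zero).comp ?_
    exact (tendsto_norm_cocompact_atTop (E := E)).comp
      (Homeomorph.subLeft x).isClosedEmbedding.tendsto_cocompact
  obtain ⟨p, hp⟩ := hcont.exists_forall_le' x (hlim.eventually_ge_atTop _)
  exact ⟨p, hp⟩

theorem exists_proxSet_eq_singleton {E : Type*} [NormedAddCommGroup E] [InnerProductSpace ℝ E]
    [FiniteDimensional ℝ E] {lam : ℝ} (hlam : 0 < lam) {f : E → ℝ}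
    (hf : ConvexOn ℝ Set.univ f) (hf0 : ∀ y, 0 ≤ f y) (x : E) : ∃ p, proxSet lam f x = {p} := by
  have : ProperSpace E := FiniteDimensional.proper ℝ E
  have hcont : Continuous f := continuousOn_univ.1 (hf.continuousOn isOpen_univ)
  exact Set.exists_eq_singleton_iff_nonempty_subsingleton.2
    ⟨proxSet_nonempty hlam hcont hf0 x, proxSet_subsingleton hlam hf x⟩

/-- A point that does at least as well as a minimizer is a minimizer. -/
theorem mem_proxSet_of_le {E : Type*} [NormedAddCommGroup E] {lam : ℝ} (hlam : 0 < lam)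
    {f : E → ℝ} {x p q : E} (hp : p ∈ proxSet lam f x) (hfq : f q = f p)
    (hq : ‖x - q‖ ^ 2 ≤ ‖x - p‖ ^ 2) : q ∈ proxSet lam f x := by
  intro y
  have hc : 0 < 1 / (2 * lam) := by positivity
  have := mul_le_mul_of_nonneg_left hq hc.le
  have := hp y
  rw [hfq]
  linarith

/-! ### Symmetric gauge functions -/

namespace IsSymmetricGauge

variable {d : ℕ} {g : EuclideanSpace ℝ (Fin d) → ℝ}

theorem map_perm (hg : IsSymmetricGauge g) (π : Equiv.Perm (Fin d)) (x : EuclideanSpace ℝ (Fin d)) :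
    g (WithLp.toLp 2 fun i => x (π i)) = g x := by
  simpa using hg.symmetric (fun _ => 1) (fun _ => Or.inl rfl) π x

theorem map_abs_perm (hg : IsSymmetricGauge g) (π : Equiv.Perm (Fin d))
    (x : EuclideanSpace ℝ (Fin d)) : g (WithLp.toLp 2 fun i => |x (π i)|) = g x := by
  rw [← hg.symmetric (fun i => if 0 ≤ x (π i) then 1 else -1)
    (fun i => by by_cases h : 0 ≤ x (π i) <;> simp [h]) π x]
  congr 2
  funext i
  by_cases h : 0 ≤ x (π i)
  · simp [h, abs_of_nonneg]
  · simp [h, abs_of_neg (not_le.1 h)]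

variable {lam : ℝ} {s p : EuclideanSpace ℝ (Fin d)}

/-- Replacing the coordinates of a minimizer by their absolute values cannot increase the
objective, so the unique minimizer is already nonnegative. -/
theorem nonneg_of_proxSet_eq (hg : IsSymmetricGauge g) (hlam : 0 < lam) (hs : ∀ i, 0 ≤ s i)
    (hp : proxSet lam g s = {p}) (i : Fin d) : 0 ≤ p i := by
  have hmem : p ∈ proxSet lam g s := by simp [hp]
  have habs : (WithLp.toLp 2 fun i => |p i|) ∈ proxSet lam g s := by
    refine mem_proxSet_of_le hlam hmem (hg.map_abs_perm 1 p) ?_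
    rw [EuclideanSpace.norm_sq_eq, EuclideanSpace.norm_sq_eq]
    refine Finset.sum_le_sum fun i _ => ?_
    simp only [PiLp.sub_apply, Real.norm_eq_abs, sq_abs]
    nlinarith [hs i, le_abs_self (p i), sq_abs (p i)]
  rw [hp, Set.mem_singleton_iff] at habs
  rw [← habs]
  exact abs_nonneg _

theorem proxSet_perm (hg : IsSymmetricGauge g) (hp : proxSet lam g s = {p})
    (hsub : ∀ x, (proxSet lam g x).Subsingleton) (π : Equiv.Perm (Fin d)) :
    proxSet lam g (WithLp.toLp 2 fun i => s (π i)) = {WithLp.toLp 2 fun i => p (π i)} := by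
  have hmem : p ∈ proxSet lam g s := by simp [hp]
  refine (hsub _).eq_singleton_of_mem fun y => ?_
  have hnorm : ∀ a b : EuclideanSpace ℝ (Fin d),
      ‖(WithLp.toLp 2 fun i => a (π i) : EuclideanSpace ℝ (Fin d)) -
        WithLp.toLp 2 fun i => b (π i)‖ ^ 2 = ‖a - b‖ ^ 2 := by
    intro a b
    rw [EuclideanSpace.norm_sq_eq, EuclideanSpace.norm_sq_eq]
    exact Equiv.sum_comp π fun i => ‖(a - b) i‖ ^ 2
  have hy : y = WithLp.toLp 2 fun i =>
      (WithLp.toLp 2 fun i => y (π.symm i) : EuclideanSpace ℝ (Fin d)) (π i) := by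
    ext i; simp
  rw [hy, hnorm, hnorm, hg.map_perm, hg.map_perm]
  exact hmem _

/-- If a minimizer were increasing somewhere along a decreasing `s`, then exchanging the two
coordinates would not increase the objective, against uniqueness. -/
theorem antitone_of_proxSet_eq (hg : IsSymmetricGauge g) (hlam : 0 < lam) (hs : Antitone s)
    (hp : proxSet lam g s = {p}) : Antitone p := by
  intro i j hij
  by_contra! hlt
  have hne : i ≠ j := by rintro rfl; exact lt_irrefl _ hlt
  have hmem : p ∈ proxSet lam g s := by simp [hp]
  have hswap : (WithLp.toLp 2 fun k => p (Equiv.swap i j k)) ∈ proxSet lam g s := by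
    refine mem_proxSet_of_le hlam hmem (hg.map_perm _ p) ?_
    rw [EuclideanSpace.norm_sq_eq, EuclideanSpace.norm_sq_eq, ← sub_nonpos,
      ← Finset.sum_sub_distrib]
    rw [Finset.sum_eq_add_of_mem i j (Finset.mem_univ _) (Finset.mem_univ _) hne]
    · simp only [PiLp.sub_apply, Real.norm_eq_abs, sq_abs, Equiv.swap_apply_left,
        Equiv.swap_apply_right]
      nlinarith [mul_nonneg (sub_nonneg.2 (hs hij)) (sub_nonneg.2 hlt.le)]
    · intro k _ hk
      simp [Equiv.swap_apply_of_ne_of_ne hk.1 hk.2]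
  rw [hp, Set.mem_singleton_iff] at hswap
  have := congrArg (fun v : EuclideanSpace ℝ (Fin d) => v i) hswap
  simp only [Equiv.swap_apply_left] at this
  exact hlt.ne' this

end IsSymmetricGauge

/-! ### The Frobenius norm and orthogonal matrices -/

theorem Matrix.frobenius_norm_sq {m n : ℕ} (A : Matrix (Fin m) (Fin n) ℝ) :
    ‖A‖ ^ 2 = ∑ i, ∑ j, A i j ^ 2 := by
  rw [Matrix.frobenius_norm_def, ← Real.sqrt_eq_rpow, Real.sq_sqrt (by positivity)]
  simp

theorem Matrix.frobenius_norm_sq_eq_trace {m n : ℕ} (A : Matrix (Fin m) (Fin n) ℝ) :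
    ‖A‖ ^ 2 = (Aᵀ * A).trace := by
  rw [Matrix.frobenius_norm_sq, Finset.sum_comm]
  simp [Matrix.trace, Matrix.mul_apply, sq]

instance Matrix.innerProductSpaceable_frobenius {m n : ℕ} :
    InnerProductSpaceable (Matrix (Fin m) (Fin n) ℝ) where
  parallelogram_identity A B := by
    simp only [← sq, Matrix.frobenius_norm_sq]
    simp only [← Finset.sum_add_distrib, Finset.mul_sum]
    refine Finset.sum_congr rfl fun i _ => Finset.sum_congr rfl fun j _ => ?_
    simp only [Matrix.add_apply, Matrix.sub_apply]
    ring

theorem Matrix.frobenius_norm_orthogonal_mul_mul {m n : ℕ} {U : Matrix (Fin m) (Fin m) ℝ}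
    {V : Matrix (Fin n) (Fin n) ℝ} (hU : U ∈ Matrix.orthogonalGroup (Fin m) ℝ)
    (hV : V ∈ Matrix.orthogonalGroup (Fin n) ℝ) (A : Matrix (Fin m) (Fin n) ℝ) :
    ‖U * A * Vᵀ‖ ^ 2 = ‖A‖ ^ 2 := by
  have hU' : Uᵀ * U = 1 := (Matrix.mem_orthogonalGroup_iff' _ _).1 hU
  have hV' : Vᵀ * V = 1 := (Matrix.mem_orthogonalGroup_iff' _ _).1 hV
  rw [Matrix.frobenius_norm_sq_eq_trace, Matrix.frobenius_norm_sq_eq_trace]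
  have : (U * A * Vᵀ)ᵀ * (U * A * Vᵀ) = V * (Aᵀ * (Uᵀ * U) * A) * Vᵀ := by
    simp only [Matrix.transpose_mul, Matrix.transpose_transpose, Matrix.mul_assoc]
  rw [this, hU', Matrix.trace_mul_cycle, hV', Matrix.mul_one, Matrix.one_mul]

theorem Matrix.orthogonal_mul_transpose_mul_mul {m n : ℕ} {U : Matrix (Fin m) (Fin m) ℝ}
    {V : Matrix (Fin n) (Fin n) ℝ} (hU : U ∈ Matrix.orthogonalGroup (Fin m) ℝ)
    (hV : V ∈ Matrix.orthogonalGroup (Fin n) ℝ) (A : Matrix (Fin m) (Fin n) ℝ) :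
    U * (Uᵀ * A * V) * Vᵀ = A := by
  have hU' : U * Uᵀ = 1 := (Matrix.mem_orthogonalGroup_iff _ _).1 hU
  have hV' : V * Vᵀ = 1 := (Matrix.mem_orthogonalGroup_iff _ _).1 hV
  calc U * (Uᵀ * A * V) * Vᵀ = (U * Uᵀ) * A * (V * Vᵀ) := by simp only [Matrix.mul_assoc]
    _ = A := by rw [hU', hV', Matrix.one_mul, Matrix.mul_one]

theorem Matrix.diagonal_units_mem_orthogonalGroup {k : ℕ} (ε : Fin k → ℤˣ) :
    Matrix.diagonal (fun i => ((ε i : ℤ) : ℝ)) ∈ Matrix.orthogonalGroup (Fin k) ℝ := by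
  rw [Matrix.mem_orthogonalGroup_iff, Matrix.diagonal_transpose,
    Matrix.diagonal_mul_diagonal, ← Matrix.diagonal_one]
  congr 1
  funext i
  rcases Int.units_eq_one_or (ε i) with h | h <;> simp [h]

/-! ### Rectangular diagonal matrices -/

section RectDiagonal

variable {m n : ℕ}

/-- The main diagonal of an `m × n` matrix, as a vector of length `min m n`. -/
def diagPart (Y : Matrix (Fin m) (Fin n) ℝ) : EuclideanSpace ℝ (Fin (min m n)) :=
  WithLp.toLp 2 fun i => Y (i.castLE (min_le_left m n)) (i.castLE (min_le_right m n))

@[simp]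
theorem diagPart_apply (Y : Matrix (Fin m) (Fin n) ℝ) (i : Fin (min m n)) :
    diagPart Y i = Y (i.castLE (min_le_left m n)) (i.castLE (min_le_right m n)) := rfl

@[simp]
theorem diagPart_rectDiagonal (s : EuclideanSpace ℝ (Fin (min m n))) :
    diagPart (rectDiagonal s : Matrix (Fin m) (Fin n) ℝ) = s := by
  ext i
  simp [rectDiagonal]

theorem diagPart_sub (Y Z : Matrix (Fin m) (Fin n) ℝ) :
    diagPart (Y - Z) = diagPart Y - diagPart Z := by
  ext i
  simp

theorem rectDiagonal_add (s u : EuclideanSpace ℝ (Fin (min m n))) :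
    (rectDiagonal (s + u) : Matrix (Fin m) (Fin n) ℝ) = rectDiagonal s + rectDiagonal u := by
  ext i j
  by_cases h : (i : ℕ) = j <;> simp [rectDiagonal, h]

theorem rectDiagonal_smul (a : ℝ) (s : EuclideanSpace ℝ (Fin (min m n))) :
    (rectDiagonal (a • s) : Matrix (Fin m) (Fin n) ℝ) = a • rectDiagonal s := by
  ext i j
  by_cases h : (i : ℕ) = j <;> simp [rectDiagonal, h]

theorem rectDiagonal_sub (s u : EuclideanSpace ℝ (Fin (min m n))) :
    (rectDiagonal (s - u) : Matrix (Fin m) (Fin n) ℝ) = rectDiagonal s - rectDiagonal u := by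
  ext i j
  by_cases h : (i : ℕ) = j <;> simp [rectDiagonal, h]

theorem diagIndex_injective : Function.Injective fun i : Fin (min m n) =>
    (i.castLE (min_le_left m n), i.castLE (min_le_right m n)) := by
  intro i j h
  simpa [Fin.ext_iff] using h

theorem norm_rectDiagonal_sq (s : EuclideanSpace ℝ (Fin (min m n))) :
    ‖(rectDiagonal s : Matrix (Fin m) (Fin n) ℝ)‖ ^ 2 = ‖s‖ ^ 2 := by
  rw [Matrix.frobenius_norm_sq, EuclideanSpace.norm_sq_eq, ← Fintype.sum_prod_type']
  symm
  refine Fintype.sum_of_injective _ diagIndex_injective _ _ ?_ ?_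
  · rintro ⟨i, j⟩ hij
    have : (i : ℕ) ≠ j := fun h =>
      hij ⟨⟨i, lt_min i.isLt (h ▸ j.isLt)⟩, Prod.ext rfl (Fin.ext h)⟩
    simp [rectDiagonal, this]
  · intro i
    simp [rectDiagonal]

theorem norm_diagPart_sq_le (Y : Matrix (Fin m) (Fin n) ℝ) : ‖diagPart Y‖ ^ 2 ≤ ‖Y‖ ^ 2 := by
  rw [Matrix.frobenius_norm_sq, EuclideanSpace.norm_sq_eq, ← Fintype.sum_prod_type']
  have := Finset.sum_image (s := Finset.univ) (f := fun p : Fin m × Fin n => Y p.1 p.2 ^ 2)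
    (diagIndex_injective (m := m) (n := n)).injOn
  simp only [diagPart_apply, Real.norm_eq_abs, sq_abs]
  rw [← this]
  exact Finset.sum_le_sum_of_subset_of_nonneg (Finset.subset_univ _)
    fun _ _ _ => sq_nonneg _

/-- Distinct signs are uncorrelated over all sign vectors. -/
theorem sum_units_mul_units {k : ℕ} (i j : Fin k) :
    ∑ ε : Fin k → ℤˣ, ((ε i : ℤ) : ℝ) * ((ε j : ℤ) : ℝ) =
      if i = j then (Fintype.card (Fin k → ℤˣ) : ℝ) else 0 := by
  split_ifs with h
  · subst h
    have : ∀ ε : Fin k → ℤˣ, ((ε i : ℤ) : ℝ) * ((ε i : ℤ) : ℝ) = 1 := fun ε => by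
      rcases Int.units_eq_one_or (ε i) with h | h <;> simp [h]
    simp [this]
  · -- flipping the `i`-th sign reverses the sign of the sum
    have hflip := Equiv.sum_comp (Equiv.mulLeft (Pi.mulSingle i (-1) : Fin k → ℤˣ))
      fun ε : Fin k → ℤˣ => ((ε i : ℤ) : ℝ) * ((ε j : ℤ) : ℝ)
    simp only [Equiv.coe_mulLeft, Pi.mul_apply, Pi.mulSingle_eq_same,
      Pi.mulSingle_eq_of_ne (Ne.symm h), one_mul, neg_mul, Units.val_neg, Int.cast_neg,
      Finset.sum_neg_distrib] at hflip
    linarith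

/-- Pinching: the rectangular diagonal part of `Y` is the average of the matrices `D Y D'`, where
`D` and `D'` are diagonal matrices carrying the same signs, so it is no larger than `Y` in a
unitarily invariant norm. -/
theorem IsUnitarilyInvariantNorm.map_rectDiagonal_diagPart_le
    {N : Seminorm ℝ (Matrix (Fin m) (Fin n) ℝ)} (hN : IsUnitarilyInvariantNorm N)
    (Y : Matrix (Fin m) (Fin n) ℝ) : N (rectDiagonal (diagPart Y)) ≤ N Y := by
  let D (ε : Fin (max m n) → ℤˣ) : Matrix (Fin m) (Fin m) ℝ :=
    Matrix.diagonal fun i => ((ε (i.castLE (le_max_left m n)) : ℤ) : ℝ)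
  let D' (ε : Fin (max m n) → ℤˣ) : Matrix (Fin n) (Fin n) ℝ :=
    Matrix.diagonal fun i => ((ε (i.castLE (le_max_right m n)) : ℤ) : ℝ)
  set c : ℝ := (Fintype.card (Fin (max m n) → ℤˣ) : ℝ) with hc
  have hcpos : 0 < c := by
    rw [hc]
    exact_mod_cast Fintype.card_pos
  have hsum : c • rectDiagonal (diagPart Y) = ∑ ε, D ε * Y * (D' ε)ᵀ := by
    ext i j
    have hentry : ∀ ε, (D ε * Y * (D' ε)ᵀ) i j =
        ((ε (i.castLE (le_max_left m n)) : ℤ) : ℝ) *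
          ((ε (j.castLE (le_max_right m n)) : ℤ) : ℝ) * Y i j := fun ε => by
      simp only [D, D', Matrix.diagonal_transpose, Matrix.mul_diagonal, Matrix.diagonal_mul]
      ring
    rw [Matrix.sum_apply]
    simp only [hentry]
    rw [← Finset.sum_mul, sum_units_mul_units]
    by_cases h : (i : ℕ) = j
    · simp [rectDiagonal, h, hc, Fin.castLE]
    · simp [rectDiagonal, Fin.ext_iff, h]
  have hle : c * N (rectDiagonal (diagPart Y)) ≤ c * N Y := by
    calc c * N (rectDiagonal (diagPart Y)) = N (c • rectDiagonal (diagPart Y)) := by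
          rw [map_smul_eq_mul, Real.norm_of_nonneg hcpos.le]
      _ ≤ ∑ ε, N (D ε * Y * (D' ε)ᵀ) := by
          rw [hsum]
          exact Finset.le_sum_of_subadditive N (map_zero N).le (map_add_le_add N) _ _
      _ = c * N Y := by
          rw [Finset.sum_congr rfl fun ε _ => hN.invariant Y (D ε)
            (Matrix.diagonal_units_mem_orthogonalGroup _) (D' ε)
            (Matrix.diagonal_units_mem_orthogonalGroup _)]
          simp [hc]
  exact le_of_mul_le_mul_left hle hcpos

end RectDiagonal

/-! ### Singular values -/

theorem Antitone.eq_of_comp_perm {k : ℕ} {f h : Fin k → ℝ} (hf : Antitone f) (hh : Antitone h)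
    {π : Equiv.Perm (Fin k)} (hπ : f = h ∘ π) : f = h := by
  subst hπ
  exact Tuple.unique_antitone (τ := 1) hf hh

theorem exists_perm_of_map_univ_eq {k : ℕ} {f h : Fin k → ℝ}
    (hfh : Multiset.map f Finset.univ.val = Multiset.map h Finset.univ.val) :
    ∃ π : Equiv.Perm (Fin k), f = h ∘ π := by
  have hperm : (List.ofFn f).Perm (List.ofFn h) := by
    rwa [Fin.univ_val_map, Fin.univ_val_map, Multiset.coe_eq_coe] at hfh
  -- both tuples have the same sorted version
  have hsort : f ∘ Tuple.sort f = h ∘ Tuple.sort h := by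
    refine List.ofFn_injective (List.Perm.eq_of_sortedLE
      (Tuple.monotone_sort f).sortedLE_ofFn (Tuple.monotone_sort h).sortedLE_ofFn ?_)
    exact ((Tuple.sort f).ofFn_comp_perm f).trans
      (hperm.trans ((Tuple.sort h).ofFn_comp_perm h).symm)
  refine ⟨(Tuple.sort f).symm.trans (Tuple.sort h), funext fun i => ?_⟩
  simpa using congrFun hsort ((Tuple.sort f).symm i)

/-- Zero padding on the right can be cancelled: two sequences that vanish from index `t` on and
have the same first `n ≥ t` values up to order have the same first `t` values up to order. -/
theorem map_range_eq_of_map_univ_eq {t n : ℕ} (htn : t ≤ n) {F G : ℕ → ℝ}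
    (hF : ∀ i, t ≤ i → F i = 0) (hG : ∀ i, t ≤ i → G i = 0)
    (h : Multiset.map (fun i : Fin n => F i) Finset.univ.val =
      Multiset.map (fun i : Fin n => G i) Finset.univ.val) :
    Multiset.map (fun i : Fin t => F i) Finset.univ.val =
      Multiset.map (fun i : Fin t => G i) Finset.univ.val := by
  have key : ∀ (k : ℕ) (H : ℕ → ℝ), Multiset.map (fun i : Fin k => H i) Finset.univ.val =
      Multiset.map H (Multiset.range k) := fun k H => by
    rw [Fin.univ_val_map, ← Multiset.coe_range, Multiset.map_coe, List.ofFn_eq_map,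
      ← List.map_coe_finRange_eq_range, List.map_map]
    rfl
  obtain ⟨k, rfl⟩ := Nat.exists_eq_add_of_le htn
  rw [key, key] at h ⊢
  rw [Multiset.range_add, Multiset.map_add, Multiset.map_add, Multiset.map_map,
    Multiset.map_map] at h
  have hFG : Multiset.map (F ∘ fun x => t + x) (Multiset.range k) =
      Multiset.map (G ∘ fun x => t + x) (Multiset.range k) :=
    Multiset.map_congr rfl fun i _ => by simp [hF, hG]
  rw [hFG] at h
  exact add_right_cancel h

section SVD

variable {m n : ℕ}

theorem singularVector_antitone (X : Matrix (Fin m) (Fin n) ℝ) : Antitone (singularVector X) :=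
  fun _ _ hij => X.toEuclideanLin.singularValues_antitone hij

theorem singularVector_nonneg (X : Matrix (Fin m) (Fin n) ℝ) (i : Fin (min m n)) :
    0 ≤ singularVector X i :=
  X.toEuclideanLin.singularValues_nonneg i

theorem singularValues_eq_zero_of_min_le (X : Matrix (Fin m) (Fin n) ℝ) {i : ℕ}
    (hi : min m n ≤ i) : X.toEuclideanLin.singularValues i = 0 := by
  rw [LinearMap.singularValues_eq_zero_iff_le_finrank_range]
  refine le_trans (le_min ?_ ?_) hi
  · simpa using Submodule.finrank_le X.toEuclideanLin.range
  · simpa using X.toEuclideanLin.finrank_range_le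

theorem rectDiagonal_transpose_mul_self (s : EuclideanSpace ℝ (Fin (min m n))) :
    (rectDiagonal s : Matrix (Fin m) (Fin n) ℝ)ᵀ * rectDiagonal s =
      Matrix.diagonal fun j : Fin n =>
        if h : (j : ℕ) < min m n then s ⟨j, h⟩ ^ 2 else 0 := by
  ext j k
  rw [Matrix.mul_apply]
  by_cases hj : (j : ℕ) < m
  · rw [Finset.sum_eq_single (⟨j, hj⟩ : Fin m)]
    · by_cases hjk : j = k
      · subst hjk
        simp [rectDiagonal, hj, sq]
      · simp [rectDiagonal, hjk, Fin.val_inj]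
    · intro i _ hi
      have : (i : ℕ) ≠ j := fun h => hi (Fin.ext h)
      simp [rectDiagonal, this]
    · simp
  · have : ∀ i : Fin m, (i : ℕ) ≠ j := fun i h => hj (h ▸ i.isLt)
    rw [Finset.sum_eq_zero fun i _ => by simp [rectDiagonal, this]]
    by_cases hjk : j = k
    · subst hjk
      simp [hj]
    · simp [hjk]

theorem map_sq_singularValues (X : Matrix (Fin m) (Fin n) ℝ) :
    Multiset.map (fun i : Fin n => X.toEuclideanLin.singularValues i ^ 2) Finset.univ.val =
      (Xᵀ * X).charpoly.roots := by
  have hn : Module.finrank ℝ (EuclideanSpace ℝ (Fin n)) = n := by simp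
  have h := X.toEuclideanLin.isSymmetric_adjoint_comp_self.roots_charpoly_eq_eigenvalues hn
  have hcp : (X.toEuclideanLin.adjoint ∘ₗ X.toEuclideanLin).charpoly = (Xᵀ * X).charpoly := by
    rw [← Matrix.toEuclideanLin_conjTranspose_eq_adjoint,
      Matrix.conjTranspose_eq_transpose_of_trivial]
    rw [← Matrix.charpoly_toLin (Xᵀ * X) (EuclideanSpace.basisFun (Fin n) ℝ).toBasis]
    congr 1
    rw [Matrix.toLin_mul _ (EuclideanSpace.basisFun (Fin m) ℝ).toBasis]
    rfl
  rw [hcp] at h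
  rw [h]
  exact Multiset.map_congr rfl fun i _ => by
    simp [X.toEuclideanLin.sq_singularValues_fin hn]

/-- The singular values of `U Σ Vᵀ` are the absolute values of the diagonal entries of `Σ`, because
their squares are the eigenvalues of `V Σᵀ Σ Vᵀ`. -/
theorem exists_perm_singularVector {U : Matrix (Fin m) (Fin m) ℝ} {V : Matrix (Fin n) (Fin n) ℝ}
    (hU : U ∈ Matrix.orthogonalGroup (Fin m) ℝ) (hV : V ∈ Matrix.orthogonalGroup (Fin n) ℝ)
    (s : EuclideanSpace ℝ (Fin (min m n))) :
    ∃ π : Equiv.Perm (Fin (min m n)),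
      ∀ i, singularVector (U * rectDiagonal s * Vᵀ) i = |s (π i)| := by
  set X : Matrix (Fin m) (Fin n) ℝ := U * rectDiagonal s * Vᵀ with hX
  have hU' : Uᵀ * U = 1 := (Matrix.mem_orthogonalGroup_iff' _ _).1 hU
  have hV' : Vᵀ * V = 1 := (Matrix.mem_orthogonalGroup_iff' _ _).1 hV
  have hcp : (Xᵀ * X).charpoly =
      ((rectDiagonal s : Matrix (Fin m) (Fin n) ℝ)ᵀ * rectDiagonal s).charpoly := by
    have : Xᵀ * X = V * ((rectDiagonal s : Matrix (Fin m) (Fin n) ℝ)ᵀ * (Uᵀ * U) *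
        rectDiagonal s * Vᵀ) := by
      simp only [hX, Matrix.transpose_mul, Matrix.transpose_transpose, Matrix.mul_assoc]
    rw [this, hU', Matrix.mul_one, Matrix.charpoly_mul_comm, Matrix.mul_assoc, hV', Matrix.mul_one]
  have hroots := map_sq_singularValues X
  rw [hcp, rectDiagonal_transpose_mul_self, Matrix.charpoly_diagonal,
    Polynomial.roots_prod _ _ (by simp [Finset.prod_ne_zero_iff, Polynomial.X_sub_C_ne_zero])]
    at hroots
  simp only [Polynomial.roots_X_sub_C, Multiset.bind_singleton] at hroots
  have habs := congrArg (Multiset.map Real.sqrt) hroots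
  rw [Multiset.map_map, Multiset.map_map] at habs
  have := map_range_eq_of_map_univ_eq (min_le_right m n)
    (F := fun i => X.toEuclideanLin.singularValues i)
    (G := fun i => if h : i < min m n then |s ⟨i, h⟩| else 0)
    (fun i hi => singularValues_eq_zero_of_min_le X hi) (fun i hi => by simp [not_lt.2 hi]) (by
      refine (Multiset.map_congr rfl fun i _ => ?_).trans
        (habs.trans (Multiset.map_congr rfl fun i _ => ?_))
      · exact (Real.sqrt_sq (X.toEuclideanLin.singularValues_nonneg i)).symm
      · by_cases h : (i : ℕ) < min m n
        · simp only [Function.comp_apply, dif_pos h, Real.sqrt_sq_eq_abs]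
        · simp only [Function.comp_apply, dif_neg h, Real.sqrt_zero])
  obtain ⟨π, hπ⟩ := exists_perm_of_map_univ_eq this
  refine ⟨π, fun i => (congrFun hπ i).trans ?_⟩
  simp only [Function.comp_apply, (π i).isLt, dif_pos, Fin.eta]

/-- Existence of the singular value decomposition: the right singular vectors are an orthonormal
eigenbasis `b` of `XᵀX`, and the normalized nonzero vectors among the `X b i` extend to an
orthonormal basis of left singular vectors. -/
theorem exists_isSVD_singularVector (X : Matrix (Fin m) (Fin n) ℝ) :
    ∃ U V, IsSVD X U (singularVector X) V := by
  have hn : Module.finrank ℝ (EuclideanSpace ℝ (Fin n)) = n := by simp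
  set T := X.toEuclideanLin with hT
  let b := T.isSymmetric_adjoint_comp_self.eigenvectorBasis hn
  have hinner : ∀ i j : Fin n, inner ℝ (T (b i)) (T (b j)) =
      if i = j then T.singularValues i ^ 2 else 0 := by
    intro i j
    rw [← LinearMap.adjoint_inner_right, ← LinearMap.comp_apply,
      LinearMap.IsSymmetric.apply_eigenvectorBasis, inner_smul_right,
      orthonormal_iff_ite.1 b.orthonormal, T.sq_singularValues_fin hn]
    split_ifs with h
    · simp [h]
    · simp
  -- only the values of `v` on `S` matter: there `i < n` and the singular value is nonzero
  let v : Fin m → EuclideanSpace ℝ (Fin m) := fun i =>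
    if h : (i : ℕ) < n then (T.singularValues i)⁻¹ • T (b ⟨i, h⟩) else 0
  let S : Set (Fin m) := {i | T.singularValues i ≠ 0}
  have hSlt : ∀ i ∈ S, (i : ℕ) < n := by
    intro i hi
    by_contra! h
    exact hi (singularValues_eq_zero_of_min_le X ((min_le_right m n).trans h))
  have hv : Orthonormal ℝ (S.domRestrict v) := by
    rw [orthonormal_iff_ite]
    rintro ⟨i, hi⟩ ⟨j, hj⟩
    simp only [Set.domRestrict_apply, v, dif_pos (hSlt i hi), dif_pos (hSlt j hj),
      inner_smul_left, inner_smul_right, hinner]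
    by_cases h : i = j
    · subst h
      have : T.singularValues i ≠ 0 := hi
      simp
      field_simp
    · simp [h, Fin.val_inj]
  obtain ⟨u, hu⟩ := hv.exists_orthonormalBasis_extension_of_card_eq (by simp)
  refine ⟨(EuclideanSpace.basisFun (Fin m) ℝ).toBasis.toMatrix u,
    (EuclideanSpace.basisFun (Fin n) ℝ).toBasis.toMatrix b,
    OrthonormalBasis.toMatrix_orthonormalBasis_mem_orthogonal _ _,
    OrthonormalBasis.toMatrix_orthonormalBasis_mem_orthogonal _ _,
    singularVector_nonneg X, ?_⟩
  set U := (EuclideanSpace.basisFun (Fin m) ℝ).toBasis.toMatrix u with hUdef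
  set V := (EuclideanSpace.basisFun (Fin n) ℝ).toBasis.toMatrix b with hVdef
  have hV : V * Vᵀ = 1 := (Matrix.mem_orthogonalGroup_iff _ _).1
    (OrthonormalBasis.toMatrix_orthonormalBasis_mem_orthogonal _ _)
  have hXV : X * V = U * rectDiagonal (singularVector X) := by
    ext i j
    have hleft : (X * V) i j = T (b j) i := by
      simp [hT, hVdef, Matrix.mul_apply, Module.Basis.toMatrix_apply, Matrix.mulVec, dotProduct]
    rw [hleft, Matrix.mul_apply]
    by_cases hj : (j : ℕ) < m
    · rw [Finset.sum_eq_single (⟨j, hj⟩ : Fin m)]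
      · have hσ : rectDiagonal (singularVector X) (⟨j, hj⟩ : Fin m) j = T.singularValues j := by
          simp [rectDiagonal, singularVector, hT]
        rw [hσ]
        -- where the singular value vanishes, so does `T (b j)`, and `u j` plays no role
        by_cases h0 : T.singularValues j = 0
        · have : T (b j) = 0 := by
            rw [← inner_self_eq_zero (𝕜 := ℝ), hinner]
            simp [h0]
          simp [this, h0]
        · have hmem : (⟨j, hj⟩ : Fin m) ∈ S := h0
          have huj : U i ⟨j, hj⟩ = u ⟨j, hj⟩ i := by
            simp [hUdef, Module.Basis.toMatrix_apply]
          rw [huj, hu _ hmem]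
          simp only [v, dif_pos j.isLt, PiLp.smul_apply, smul_eq_mul]
          field_simp
      · intro k _ hk
        have : (k : ℕ) ≠ j := fun h => hk (Fin.ext h)
        simp [rectDiagonal, this]
      · simp
    · have hne : ∀ k : Fin m, (k : ℕ) ≠ j := fun k h => hj (h ▸ k.isLt)
      rw [Finset.sum_eq_zero fun k _ => by simp [rectDiagonal, hne]]
      have h0 : T.singularValues j = 0 :=
        singularValues_eq_zero_of_min_le X ((min_le_left m n).trans (not_lt.1 hj))
      have : T (b j) = 0 := by
        rw [← inner_self_eq_zero (𝕜 := ℝ), hinner]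
        simp [h0]
      simp [this]
  rw [← hXV, Matrix.mul_assoc, hV, Matrix.mul_one]

end SVD

/-! ### The gauge of a unitarily invariant norm and its proximal operator -/

section Gauge

variable {m n : ℕ} {N : Seminorm ℝ (Matrix (Fin m) (Fin n) ℝ)}

theorem IsUnitarilyInvariantNorm.map_of_isSVD (hN : IsUnitarilyInvariantNorm N)
    {X : Matrix (Fin m) (Fin n) ℝ} {U : Matrix (Fin m) (Fin m) ℝ}
    {s : EuclideanSpace ℝ (Fin (min m n))} {V : Matrix (Fin n) (Fin n) ℝ}
    (h : IsSVD X U s V) : N X = N (rectDiagonal s) := by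
  rw [h.eq, hN.invariant _ U h.left_mem V h.right_mem]

theorem exists_perm_singularVector_rectDiagonal (s : EuclideanSpace ℝ (Fin (min m n))) :
    ∃ π : Equiv.Perm (Fin (min m n)),
      ∀ i, singularVector (rectDiagonal s : Matrix (Fin m) (Fin n) ℝ) i = |s (π i)| := by
  simpa using exists_perm_singularVector (one_mem (Matrix.orthogonalGroup (Fin m) ℝ))
    (one_mem (Matrix.orthogonalGroup (Fin n) ℝ)) s

/-- A signed permutation of the diagonal does not change the singular values. -/
theorem singularVector_rectDiagonal_signed_perm (s : EuclideanSpace ℝ (Fin (min m n)))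
    {ε : Fin (min m n) → ℝ} (hε : ∀ i, ε i = 1 ∨ ε i = -1) (π : Equiv.Perm (Fin (min m n))) :
    singularVector (rectDiagonal (WithLp.toLp 2 fun i => ε i * s (π i)) :
      Matrix (Fin m) (Fin n) ℝ) = singularVector (rectDiagonal s) := by
  obtain ⟨π₁, h₁⟩ := exists_perm_singularVector_rectDiagonal (m := m) (n := n)
    (WithLp.toLp 2 fun i => ε i * s (π i))
  obtain ⟨π₂, h₂⟩ := exists_perm_singularVector_rectDiagonal (m := m) (n := n) s
  have hε' : ∀ i, |ε i| = 1 := fun i => by rcases hε i with h | h <;> simp [h]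
  have := Antitone.eq_of_comp_perm (singularVector_antitone (rectDiagonal (WithLp.toLp 2
    fun i => ε i * s (π i)) : Matrix (Fin m) (Fin n) ℝ)) (singularVector_antitone (rectDiagonal s))
    (π := (π₁.trans π).trans π₂.symm) (by
      funext i
      simp [h₁, h₂, abs_mul, hε'])
  ext i
  exact congrFun this i

theorem IsUnitarilyInvariantNorm.map_rectDiagonal_singularVector
    (hN : IsUnitarilyInvariantNorm N) (X : Matrix (Fin m) (Fin n) ℝ) :
    N (rectDiagonal (singularVector X)) = N X := by
  obtain ⟨U, V, h⟩ := exists_isSVD_singularVector X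
  exact (hN.map_of_isSVD h).symm

theorem IsUnitarilyInvariantNorm.isGaugeOf (hN : IsUnitarilyInvariantNorm N) :
    IsGaugeOf N fun s => N (rectDiagonal s) where
  norm_eq X := (hN.map_rectDiagonal_singularVector X).symm
  isSymmetricGauge :=
    { nonneg := fun s => apply_nonneg N _
      map_zero := by
        have := rectDiagonal_smul (m := m) (n := n) 0 0
        rw [zero_smul, zero_smul] at this
        rw [this, map_zero]
      pos_homogeneous := fun a ha s => by
        rw [rectDiagonal_smul, map_smul_eq_mul, Real.norm_of_nonneg ha.le]
      convex := by
        refine ⟨convex_univ, fun s _ u _ a b ha hb _ => ?_⟩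
        beta_reduce
        rw [rectDiagonal_add, rectDiagonal_smul, rectDiagonal_smul]
        refine (map_add_le_add N _ _).trans_eq ?_
        rw [map_smul_eq_mul, map_smul_eq_mul, Real.norm_of_nonneg ha, Real.norm_of_nonneg hb]
        rfl
      symmetric := fun ε hε π s => by
        rw [← hN.map_rectDiagonal_singularVector, singularVector_rectDiagonal_signed_perm s hε π,
          hN.map_rectDiagonal_singularVector] }

/-- A gauge of `N` is determined by `N`: `s` is a signed permutation of the singular values of the
rectangular diagonal matrix with diagonal `s`. -/
theorem IsGaugeOf.eq_map_rectDiagonal {g : EuclideanSpace ℝ (Fin (min m n)) → ℝ}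
    (hg : IsGaugeOf N g) : g = fun s => N (rectDiagonal s) := by
  funext s
  obtain ⟨π, hπ⟩ := exists_perm_singularVector_rectDiagonal (m := m) (n := n) s
  rw [hg.norm_eq, ← hg.isSymmetricGauge.map_abs_perm π s]
  congr 1
  ext i
  exact (hπ i).symm

/-- In the singular basis of `X`, the matrix objective at any `Y` is at least the vector objective
at the diagonal of `Uᵀ Y V`, with equality for diagonal `Uᵀ Y V`; so vector minimizers lift. -/
theorem IsUnitarilyInvariantNorm.mem_proxSet_of_isSVD (hN : IsUnitarilyInvariantNorm N) {lam : ℝ}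
    (hlam : 0 < lam) {X : Matrix (Fin m) (Fin n) ℝ} {U : Matrix (Fin m) (Fin m) ℝ}
    {s p : EuclideanSpace ℝ (Fin (min m n))} {V : Matrix (Fin n) (Fin n) ℝ} (h : IsSVD X U s V)
    (hp : p ∈ proxSet lam (fun s => N (rectDiagonal s)) s) :
    U * rectDiagonal p * Vᵀ ∈ proxSet lam N X := by
  intro Y
  have hc : 0 < 1 / (2 * lam) := by positivity
  obtain ⟨Z, rfl⟩ : ∃ Z, Y = U * Z * Vᵀ :=
    ⟨Uᵀ * Y * V, (Matrix.orthogonal_mul_transpose_mul_mul h.left_mem h.right_mem Y).symm⟩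
  have hnorm : ∀ W : Matrix (Fin m) (Fin n) ℝ,
      ‖X - U * W * Vᵀ‖ ^ 2 = ‖rectDiagonal s - W‖ ^ 2 := fun W => by
    rw [h.eq, ← Matrix.sub_mul, ← Matrix.mul_sub,
      Matrix.frobenius_norm_orthogonal_mul_mul h.left_mem h.right_mem]
  rw [hnorm, hnorm, hN.invariant _ U h.left_mem V h.right_mem,
    hN.invariant _ U h.left_mem V h.right_mem, ← rectDiagonal_sub, norm_rectDiagonal_sq]
  refine (hp (diagPart Z)).trans (add_le_add ?_ (hN.map_rectDiagonal_diagPart_le Z))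
  refine mul_le_mul_of_nonneg_left ?_ hc.le
  have := norm_diagPart_sq_le (rectDiagonal s - Z)
  rwa [diagPart_sub, diagPart_rectDiagonal] at this


theorem IsSVD.exists_perm {X : Matrix (Fin m) (Fin n) ℝ} {U : Matrix (Fin m) (Fin m) ℝ}
    {s : EuclideanSpace ℝ (Fin (min m n))} {V : Matrix (Fin n) (Fin n) ℝ} (h : IsSVD X U s V) :
    ∃ π : Equiv.Perm (Fin (min m n)), singularVector X = WithLp.toLp 2 fun i => s (π i) := by
  obtain ⟨π, hπ⟩ := exists_perm_singularVector h.left_mem h.right_mem s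
  refine ⟨π, ?_⟩
  ext i
  rw [h.eq, hπ, abs_of_nonneg (h.nonneg _)]

end Gauge

theorem mainTheorem7 {m n : ℕ} (N : Seminorm ℝ (Matrix (Fin m) (Fin n) ℝ))
    (hN : IsUnitarilyInvariantNorm N) :
    (∃! g : EuclideanSpace ℝ (Fin (min m n)) → ℝ, IsGaugeOf N g) ∧
    ∀ g : EuclideanSpace ℝ (Fin (min m n)) → ℝ, IsGaugeOf N g →
    ∀ lam : ℝ, 0 < lam →
    ∀ (X : Matrix (Fin m) (Fin n) ℝ) (U : Matrix (Fin m) (Fin m) ℝ)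
      (s : EuclideanSpace ℝ (Fin (min m n))) (V : Matrix (Fin n) (Fin n) ℝ),
    IsSVD X U s V →
    ∃ (Xhat : Matrix (Fin m) (Fin n) ℝ) (shat : EuclideanSpace ℝ (Fin (min m n))),
      proxSet lam N X = {Xhat} ∧
      proxSet lam g s = {shat} ∧
      IsSVD Xhat U shat V ∧
      proxSet lam g (singularVector X) = {singularVector Xhat} := by
  refine ⟨⟨_, hN.isGaugeOf, fun g hg => hg.eq_map_rectDiagonal⟩, ?_⟩
  intro g hgauge lam hlam X U s V hX
  have hg := hgauge.isSymmetricGauge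
  obtain ⟨p, hp⟩ := exists_proxSet_eq_singleton hlam hg.convex hg.nonneg s
  have hmem : p ∈ proxSet lam g s := by simp [hp]
  have hXhat : IsSVD (U * rectDiagonal p * Vᵀ) U p V :=
    ⟨hX.left_mem, hX.right_mem, hg.nonneg_of_proxSet_eq hlam hX.nonneg hp, rfl⟩
  refine ⟨U * rectDiagonal p * Vᵀ, p, ?_, hp, hXhat, ?_⟩
  · rw [hgauge.eq_map_rectDiagonal] at hmem
    exact (proxSet_subsingleton hlam N.convexOn X).eq_singleton_of_mem
      (hN.mem_proxSet_of_isSVD hlam hX hmem)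
  · obtain ⟨π, hπ⟩ := hX.exists_perm
    obtain ⟨π', hπ'⟩ := hXhat.exists_perm
    have hprox := hg.proxSet_perm hp (proxSet_subsingleton hlam hg.convex) π
    rw [← hπ] at hprox
    rw [hprox, Set.singleton_eq_singleton_iff]
    -- both sides are decreasing rearrangements of `p`
    have hanti := hg.antitone_of_proxSet_eq hlam (singularVector_antitone X) hprox
    have := Antitone.eq_of_comp_perm hanti (singularVector_antitone (U * rectDiagonal p * Vᵀ))
      (π := π.trans π'.symm) (by
        funext i
        simp [hπ'])
    ext i
    exact congrFun this i
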